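/- A binary linear code $C\subseteq\mathbb{F}_2^n$ of dimension $s$ is called an $[n,s,k]_P$ code ($k$-PIR code) if it admits a generator matrix $G\in\mathbb{F}_2^{s\times n}$, with columns $G^1,\dots,G^n$, such that for every $1\le i\le s$ there are $k$ mutually disjoint sets $R_{1},\dots,R_{k}\subseteq\{1,\dots,n\}$ with $\sum_{h\in R_{j}}G^h=e_i$ for all $1\le j\le k$, where $e_i$ is the $i$th unit vector of $\mathbb{F}_2^s$. Let $P(s,k)$ denote the smallest $n$ for which an $[n,s,k]_P$ code exists. Then $P(5,2)=6$, $P(5,4)=10$, $P(5,6)=14$, $P(5,8)=18$, $P(5,10)=22$, $P(5,12)=25$, $P(5,14)=28$, $P(5,16)=31$, and for all even $k>16$ we have $$P(5,k)=P(5,k-16\tau)+31\tau,\qquad\text{where } \tau=\lfloor (k-1)/16\rfloor .$$ -/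

import Mathlib

namespace PIR

/-- `G` is a generator matrix of the binary linear code `C` of length `n`: its rows form a basis
of `C`, so `C` has dimension `s`. -/
def IsGeneratorMatrix {n s : ℕ} (C : Submodule (ZMod 2) (Fin n → ZMod 2))
    (G : Matrix (Fin s) (Fin n) (ZMod 2)) : Prop :=
  LinearIndependent (ZMod 2) G.row ∧ Submodule.span (ZMod 2) (Set.range G.row) = C

/-- `R` is a recovery set for the `i`-th information bit: the columns of `G` indexed by `R` sum
to the `i`-th unit vector. -/
def IsRecoverySet {n s : ℕ} (G : Matrix (Fin s) (Fin n) (ZMod 2)) (i : Fin s)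
    (R : Finset (Fin n)) : Prop :=
  ∑ h ∈ R, G.col h = Pi.single i 1

/-- `C` is an `[n,s,k]_P` code: an `[n,s]` binary linear code admitting a generator matrix for
which every information bit has `k` mutually disjoint recovery sets. -/
def IsPIRCode (n s k : ℕ) (C : Submodule (ZMod 2) (Fin n → ZMod 2)) : Prop :=
  ∃ G : Matrix (Fin s) (Fin n) (ZMod 2), IsGeneratorMatrix C G ∧
    ∀ i : Fin s, ∃ R : Fin k → Finset (Fin n),
      (∀ j j', j ≠ j' → Disjoint (R j) (R j')) ∧ ∀ j, IsRecoverySet G i (R j)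

/-- `P s k` is the smallest length `n` of an `[n,s,k]_P` code. -/
noncomputable def P (s k : ℕ) : ℕ :=
  sInf {n : ℕ | ∃ C : Submodule (ZMod 2) (Fin n → ZMod 2), IsPIRCode n s k C}

end PIR

/-!
A code of length `n` can be normalized so that its columns are nonzero and sum to zero. For even `k`
the nonzero codewords then have even weights of at least `k`; half of the excess of these weights
over `k` is the multiplicity function `δ` of a multiset of nonzero vectors of `𝔽₂⁵`. Orthogonality
of characters shows that `δ` has total `(16 n - 31 k) / 2`, and that the number of its members off
any hyperplane is divisible by four. Counting how the recovery sets of a unit vector `e` consume the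
columns shows that at least `4 δ v` members lie off the hyperplane orthogonal to `e` whenever
`v ⬝ᵥ e = 1`, and the same count modulo a vector `q` gives a second inequality.

Divisibility forces the sum of squares of `δ` to be large, hence vectors of multiplicity at least
two, while the two inequalities limit such vectors. Together they leave only the totals `0`, `7`,
`8` and those from `14` on, which is the lower bound for `n`. It is attained by explicit codes for
`k ≤ 16`; appending a simplex code adds `31` columns and `16` recovery sets.
-/

namespace PIR

open Finset

/-- The space `𝔽₂ˢ`, which contains both the columns of a generator matrix with `s` rows and the
coefficient vectors of its codewords. -/
abbrev Vec (s : ℕ) : Type := Fin s → ZMod 2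

theorem zmod_two_eq_zero_or_one (a : ZMod 2) : a = 0 ∨ a = 1 := by
  revert a; decide

theorem add_eq_zero_iff_eq_of_zmod_two {V : Type*} [AddCommGroup V] [Module (ZMod 2) V]
    {a b : V} : a + b = 0 ↔ a = b := by
  rw [← ZModModule.sub_eq_add, sub_eq_zero]

/-! ### Characters and weights -/

section Characters

variable {s : ℕ} {v w p : Vec s}

theorem exists_apply_eq_one (hv : v ≠ 0) : ∃ i, v i = 1 := by
  by_contra! h
  exact hv (funext fun i => (zmod_two_eq_zero_or_one (v i)).resolve_right (h i))

theorem ne_zero_of_apply_eq_one {i : Fin s} (hv : v i = 1) : v ≠ 0 := by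
  rintro rfl
  simp at hv

/-- The integer `0` or `1` that represents `v ⬝ᵥ q`. -/
def ind (v q : Vec s) : ℤ := if v ⬝ᵥ q = 1 then 1 else 0

theorem ind_comm (v q : Vec s) : ind v q = ind q v := by
  rw [ind, ind, dotProduct_comm]

theorem ind_eq_one_iff {q : Vec s} : ind v q = 1 ↔ v ⬝ᵥ q = 1 := by
  unfold ind; split_ifs with h <;> simp [h]

theorem ind_eq_zero_iff {q : Vec s} : ind v q = 0 ↔ v ⬝ᵥ q = 0 := by
  unfold ind
  rcases zmod_two_eq_zero_or_one (v ⬝ᵥ q) with h | h <;> simp [h]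

theorem ind_eq_zero_or_one (v q : Vec s) : ind v q = 0 ∨ ind v q = 1 := by
  unfold ind; split_ifs <;> simp

theorem ind_nonneg (v q : Vec s) : 0 ≤ ind v q := by
  rcases ind_eq_zero_or_one v q with h | h <;> simp [h]

theorem ind_le_one (v q : Vec s) : ind v q ≤ 1 := by
  rcases ind_eq_zero_or_one v q with h | h <;> simp [h]

theorem intCast_ind (v q : Vec s) : (ind v q : ZMod 2) = v ⬝ᵥ q := by
  unfold ind
  rcases zmod_two_eq_zero_or_one (v ⬝ᵥ q) with h | h <;> simp [h]

@[simp] theorem ind_zero_left (q : Vec s) : ind 0 q = 0 := by simp [ind]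

@[simp] theorem ind_zero_right (v : Vec s) : ind v 0 = 0 := by simp [ind]

theorem ind_add_right (v q r : Vec s) :
    ind v (q + r) = ind v q + ind v r - 2 * (ind v q * ind v r) := by
  unfold ind
  rw [dotProduct_add]
  rcases zmod_two_eq_zero_or_one (v ⬝ᵥ q) with h | h <;>
    rcases zmod_two_eq_zero_or_one (v ⬝ᵥ r) with h' | h' <;> rw [h, h'] <;> decide

theorem ind_add_left (v w q : Vec s) :
    ind (v + w) q = ind v q + ind w q - 2 * (ind v q * ind w q) := by
  rw [ind_comm, ind_add_right, ind_comm q v, ind_comm q w]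

/-- The additive character `q ↦ (-1) ^ (v ⬝ᵥ q)` of `𝔽₂ˢ`, written in terms of `ind`. -/
def character (v : Vec s) : AddChar (Vec s) ℤ where
  toFun q := 1 - 2 * ind v q
  map_zero_eq_one' := by simp
  map_add_eq_mul' q r := by rw [ind_add_right]; ring

theorem character_apply (v q : Vec s) : character v q = 1 - 2 * ind v q := rfl

theorem character_add_apply (v w q : Vec s) :
    character (v + w) q = character v q * character w q := by
  simp only [character_apply, ind_add_left]; ring

theorem character_eq_zero_iff : character v = 0 ↔ v = 0 := by
  refine ⟨fun h => dotProduct_eq_zero v fun q => ind_eq_zero_iff.1 ?_, ?_⟩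
  · have hq : character v q = 1 := by rw [h, AddChar.zero_apply]
    rw [character_apply] at hq
    omega
  · rintro rfl
    ext q
    simp [character_apply]

theorem sum_character (v : Vec s) : ∑ q, character v q = if v = 0 then 2 ^ s else 0 := by
  classical
  simp only [AddChar.sum_eq_ite, character_eq_zero_iff]
  simp [ZMod.card]

theorem two_mul_sum_ind (hv : v ≠ 0) : ∑ q, 2 * ind v q = 2 ^ s := by
  have h (q : Vec s) : 2 * ind v q = character 0 q - character v q := by
    simp [character_apply]
  simp only [h, sum_sub_distrib, sum_character, if_neg hv, if_true, sub_zero]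

theorem four_mul_sum_ind_mul_ind (hv : v ≠ 0) (hw : w ≠ 0) :
    ∑ q, 4 * (ind v q * ind w q) = 2 ^ s * (1 + if v = w then 1 else 0) := by
  have h (q : Vec s) : 4 * (ind v q * ind w q) =
      character 0 q - character v q - character w q + character (v + w) q := by
    rw [character_add_apply]
    simp only [character_apply, ind_zero_left]
    ring
  simp only [h, sum_sub_distrib, sum_add_distrib, sum_character, if_neg hv, if_neg hw, if_true,
    add_eq_zero_iff_eq_of_zmod_two]
  split_ifs <;> ring

theorem four_mul_sum_orthogonal_ind (hp : p ≠ 0) (hv : v ≠ 0) (hvp : v ≠ p) :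
    ∑ q, 4 * (1 - ind p q) * ind v q = 2 ^ s := by
  have h (q : Vec s) : 4 * (1 - ind p q) * ind v q =
      2 * (2 * ind v q) - 4 * (ind p q * ind v q) := by ring
  rw [sum_congr rfl fun q _ => h q, sum_sub_distrib, ← mul_sum, two_mul_sum_ind hv,
    four_mul_sum_ind_mul_ind hp hv, if_neg hvp.symm]
  ring

theorem eight_mul_sum_orthogonal_ind_mul_ind (hp : p ≠ 0) (hv : v ≠ 0) (hw : w ≠ 0)
    (hvp : v ≠ p) (hwp : w ≠ p) (hvw : v + w ≠ p) :
    ∑ q, 8 * (1 - ind p q) * (ind v q * ind w q) = 2 ^ s * (1 + if v = w then 1 else 0) := by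
  have h (q : Vec s) : 8 * (1 - ind p q) * (ind v q * ind w q) =
      4 * (ind v q * ind w q) + character p q - character (p + v) q - character (p + w) q
        + character (p + (v + w)) q := by
    simp only [character_add_apply]
    simp only [character_apply]
    ring
  simp only [h, sum_sub_distrib, sum_add_distrib, sum_character, four_mul_sum_ind_mul_ind hv hw,
    if_neg hp, add_eq_zero_iff_eq_of_zmod_two, if_neg hvp.symm, if_neg hwp.symm, if_neg hvw.symm]
  ring

end Characters

section Mass

variable {s : ℕ} {μ : Vec s → ℤ}

/-- The total multiplicity of the vectors `v` with `v ⬝ᵥ q = 1` in the multiset of vectors with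
multiplicity function `μ`. If the multiset is regarded as the family of columns of a generator
matrix, this is the weight of the codeword with coefficient vector `q`. -/
def mass (μ : Vec s → ℤ) (q : Vec s) : ℤ := ∑ v, μ v * ind v q

@[simp] theorem mass_zero (μ : Vec s → ℤ) : mass μ 0 = 0 := by simp [mass]

theorem mass_nonneg (hμ : ∀ v, 0 ≤ μ v) (q : Vec s) : 0 ≤ mass μ q :=
  sum_nonneg fun v _ => mul_nonneg (hμ v) (ind_nonneg v q)

theorem mass_le_sum (hμ : ∀ v, 0 ≤ μ v) (q : Vec s) : mass μ q ≤ ∑ v, μ v :=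
  sum_le_sum fun v _ => mul_le_of_le_one_right (hμ v) (ind_le_one v q)

theorem sum_mul_mass {g : Vec s → ℤ} {c : ℤ}
    (hg : ∀ v, μ v ≠ 0 → ∑ q, g q * ind v q = c) :
    ∑ q, g q * mass μ q = c * ∑ v, μ v := by
  calc ∑ q, g q * mass μ q = ∑ v, μ v * ∑ q, g q * ind v q := by
        simp only [mass, mul_sum]
        rw [sum_comm]
        exact sum_congr rfl fun v _ => sum_congr rfl fun q _ => mul_left_comm _ _ _
    _ = ∑ v, c * μ v := sum_congr rfl fun v _ => by
        by_cases hv : μ v = 0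
        · simp [hv]
        · rw [hg v hv, mul_comm]
    _ = c * ∑ v, μ v := (mul_sum _ _ _).symm

theorem sum_mul_mass_sq {g : Vec s → ℤ} {c : ℤ}
    (hg : ∀ v w, μ v * μ w ≠ 0 →
      ∑ q, g q * (ind v q * ind w q) = c * (1 + if v = w then 1 else 0)) :
    ∑ q, g q * mass μ q ^ 2 = c * ((∑ v, μ v) ^ 2 + ∑ v, μ v ^ 2) := by
  calc ∑ q, g q * mass μ q ^ 2
      = ∑ v, ∑ w, μ v * μ w * ∑ q, g q * (ind v q * ind w q) := by
        have hsq (q : Vec s) : g q * mass μ q ^ 2 =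
            ∑ v, ∑ w, μ v * μ w * (g q * (ind v q * ind w q)) := by
          rw [mass, sq, sum_mul_sum]
          simp only [mul_sum]
          exact sum_congr rfl fun v _ => sum_congr rfl fun w _ => by ring
        simp only [hsq, mul_sum]
        rw [sum_comm]
        exact sum_congr rfl fun v _ => sum_comm
    _ = ∑ v, ∑ w, (c * (μ v * μ w) + if v = w then c * (μ v * μ w) else 0) :=
        sum_congr rfl fun v _ => sum_congr rfl fun w _ => by
          by_cases hvw : μ v * μ w = 0
          · simp [hvw]
          · rw [hg v w hvw]; split_ifs <;> ring
    _ = c * ((∑ v, μ v) ^ 2 + ∑ v, μ v ^ 2) := by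
        simp only [sum_add_distrib, sum_ite_eq, mem_univ, if_true, ← mul_sum, ← sum_mul, ← sq,
          ← mul_add]

theorem two_mul_sum_mass (h0 : μ 0 = 0) : 2 * ∑ q, mass μ q = 2 ^ s * ∑ v, μ v := by
  rw [mul_sum]
  exact sum_mul_mass fun v hv => two_mul_sum_ind (by rintro rfl; exact hv h0)

theorem four_mul_sum_mass_sq (h0 : μ 0 = 0) :
    4 * ∑ q, mass μ q ^ 2 = 2 ^ s * ((∑ v, μ v) ^ 2 + ∑ v, μ v ^ 2) := by
  rw [mul_sum]
  refine sum_mul_mass_sq fun v w hvw => four_mul_sum_ind_mul_ind ?_ ?_ <;> rintro rfl <;>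
    simp [h0] at hvw

/- The vectors orthogonal to `p` are the characters of the quotient by `p`, and the hypotheses say
that `μ` acquires neither zeros nor new coincidences there. -/
theorem eight_mul_sum_orthogonal_mass {p : Vec s} (hp : p ≠ 0) (h0 : μ 0 = 0) (hμp : μ p = 0)
    (hpair : ∀ v w, v + w = p → μ v * μ w = 0) :
    8 * ∑ q, (1 - ind p q) * (mass μ q ^ 2 - 4 * mass μ q) =
      2 ^ s * ((∑ v, μ v) ^ 2 + ∑ v, μ v ^ 2 - 8 * ∑ v, μ v) := by
  have hfirst : ∑ q, 4 * (1 - ind p q) * mass μ q = 2 ^ s * ∑ v, μ v :=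
    sum_mul_mass fun v hv => four_mul_sum_orthogonal_ind hp (by rintro rfl; exact hv h0)
      (by rintro rfl; exact hv hμp)
  have hsecond : ∑ q, 8 * (1 - ind p q) * mass μ q ^ 2 =
      2 ^ s * ((∑ v, μ v) ^ 2 + ∑ v, μ v ^ 2) := by
    refine sum_mul_mass_sq fun v w hvw => eight_mul_sum_orthogonal_ind_mul_ind hp ?_ ?_ ?_ ?_
      fun h => hvw (hpair v w h)
    all_goals rintro rfl; simp [h0, hμp] at hvw
  calc 8 * ∑ q, (1 - ind p q) * (mass μ q ^ 2 - 4 * mass μ q)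
      = ∑ q, 8 * (1 - ind p q) * mass μ q ^ 2 - 8 * ∑ q, 4 * (1 - ind p q) * mass μ q := by
        simp only [mul_sum, ← sum_sub_distrib]
        exact sum_congr rfl fun q _ => by ring
    _ = 2 ^ s * ((∑ v, μ v) ^ 2 + ∑ v, μ v ^ 2 - 8 * ∑ v, μ v) := by
        rw [hfirst, hsecond]; ring

/- Sum the nonnegative numbers `(x - m) (x - (m + 1))` over the integers `x = mass μ q / Δ`,
`q ≠ 0`. -/
theorem mul_sub_sum_sq_le_of_dvd_mass (h0 : μ 0 = 0) {Δ : ℤ} (hΔ : ∀ q, Δ ∣ mass μ q) (m : ℤ) :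
    2 ^ s * (2 * Δ * (2 * m + 1) * ∑ v, μ v - (∑ v, μ v) ^ 2 - ∑ v, μ v ^ 2) ≤
      4 * Δ ^ 2 * (m * (m + 1)) * (2 ^ s - 1) := by
  have hterm (q : Vec s) : 0 ≤ mass μ q ^ 2 - Δ * (2 * m + 1) * mass μ q +
      Δ ^ 2 * (m * (m + 1)) * (1 - if q = 0 then 1 else 0) := by
    split_ifs with hq
    · simp [hq]
    · obtain ⟨x, hx⟩ := hΔ q
      have hconsecutive : 0 ≤ (x - m) * (x - (m + 1)) := by
        rcases le_or_gt x m with h | h <;> nlinarith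
      rw [hx]
      nlinarith [mul_nonneg (sq_nonneg Δ) hconsecutive]
  have hsum := sum_nonneg fun q (_ : q ∈ univ) => hterm q
  simp only [sum_add_distrib, sum_sub_distrib, ← mul_sum, sum_ite_eq', mem_univ, if_true] at hsum
  have hcard : ∑ _q : Vec s, (1 : ℤ) = 2 ^ s := by simp [ZMod.card]
  rw [hcard] at hsum
  linarith [four_mul_sum_mass_sq h0, congrArg (2 * Δ * (2 * m + 1) * ·) (two_mul_sum_mass h0)]

end Mass

section SumOfSquares

variable {α : Type*} [Fintype α] {μ : α → ℤ}

theorem sum_le_sum_sq (μ : α → ℤ) : ∑ v, μ v ≤ ∑ v, μ v ^ 2 :=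
  sum_le_sum fun v _ => Int.le_self_sq (μ v)

theorem exists_two_le_of_sum_lt_sum_sq (hμ : ∀ v, 0 ≤ μ v) (h : ∑ v, μ v < ∑ v, μ v ^ 2) :
    ∃ p, 2 ≤ μ p := by
  obtain ⟨p, -, hp⟩ := exists_lt_of_sum_lt h
  exact ⟨p, by nlinarith [hμ p]⟩

theorem exists_ne_two_le_of_sum_add_lt_sum_sq (hμ : ∀ v, 0 ≤ μ v) {M : ℤ} (hM : ∀ v, μ v ≤ M)
    (h : ∑ v, μ v + M * (M - 1) < ∑ v, μ v ^ 2) : ∃ p p', p ≠ p' ∧ 2 ≤ μ p ∧ 2 ≤ μ p' := by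
  have hconsecutive : 0 ≤ M * (M - 1) := by nlinarith [Int.le_self_sq M]
  obtain ⟨p, hp⟩ := exists_two_le_of_sum_lt_sum_sq hμ (by linarith)
  by_contra! hother
  have hsum : ∑ v, (μ v ^ 2 - μ v) = μ p ^ 2 - μ p := by
    refine sum_eq_single p (fun v _ hv => ?_) (by simp)
    have hle : μ v < 2 := hother p v hv.symm hp
    have hge := hμ v
    interval_cases μ v <;> rfl
  rw [sum_sub_distrib] at hsum
  nlinarith [hM p]

theorem sum_eq_two_mul_sum_div_add_sum_mod (μ : α → ℤ) :
    ∑ v, μ v = 2 * ∑ v, μ v / 2 + ∑ v, μ v % 2 := by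
  rw [mul_sum, ← sum_add_distrib]
  exact sum_congr rfl fun v _ => (Int.mul_ediv_add_emod (μ v) 2).symm

theorem sum_sq_eq_four_mul_sum_div_add_sum_mod (hμ : ∀ v, 0 ≤ μ v) (hμ2 : ∀ v, μ v ≤ 2) :
    ∑ v, μ v ^ 2 = 4 * ∑ v, μ v / 2 + ∑ v, μ v % 2 := by
  rw [mul_sum, ← sum_add_distrib]
  refine sum_congr rfl fun v _ => ?_
  have hge := hμ v
  have hle := hμ2 v
  interval_cases μ v <;> rfl

end SumOfSquares

section EvenMass

variable {s : ℕ} {μ : Vec s → ℤ}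

theorem sum_intCast_smul_eq_zero (heven : ∀ q, Even (mass μ q)) :
    ∑ v, (μ v : ZMod 2) • v = 0 := by
  refine dotProduct_eq_zero _ fun q => ?_
  calc (∑ v, (μ v : ZMod 2) • v) ⬝ᵥ q = (mass μ q : ZMod 2) := by
        simp [mass, sum_dotProduct, intCast_ind]
    _ = 0 := (ZMod.intCast_zmod_eq_zero_iff_dvd _ 2).2 (heven q).two_dvd

theorem sum_filter_odd_eq_zero (heven : ∀ q, Even (mass μ q)) : ∑ v with Odd (μ v), v = 0 := by
  rw [← sum_intCast_smul_eq_zero heven, sum_filter]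
  refine sum_congr rfl fun v _ => ?_
  rcases (μ v).even_or_odd with h | h <;> simp [CharTwo.intCast_eq_ite, h]

theorem sum_emod_two_eq_zero_or_three_le (h0 : μ 0 = 0) (heven : ∀ q, Even (mass μ q)) :
    ∑ v, μ v % 2 = 0 ∨ 3 ≤ ∑ v, μ v % 2 := by
  have hzero := sum_filter_odd_eq_zero heven
  have hcard : ∑ v, μ v % 2 = (#{v | Odd (μ v)} : ℤ) := by
    rw [natCast_card_filter]
    refine sum_congr rfl fun v _ => ?_
    split_ifs with h
    · exact Int.odd_iff.1 h
    · exact Int.even_iff.1 (Int.not_odd_iff_even.1 h)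
  have hone : #{v | Odd (μ v)} ≠ 1 := fun h => by
    obtain ⟨a, ha⟩ := card_eq_one.1 h
    obtain rfl : a = 0 := by simpa [ha] using hzero
    have hodd : (0 : Vec s) ∈ ({v | Odd (μ v)} : Finset (Vec s)) := by simp [ha]
    simp [h0] at hodd
  have htwo : #{v | Odd (μ v)} ≠ 2 := fun h => by
    obtain ⟨a, b, hab, hpair⟩ := card_eq_two.1 h
    rw [hpair, sum_pair hab, add_eq_zero_iff_eq_of_zmod_two] at hzero
    exact hab hzero
  omega

theorem sum_ne_one_of_even_mass (h0 : μ 0 = 0) (hμ : ∀ v, 0 ≤ μ v)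
    (heven : ∀ q, Even (mass μ q)) : ∑ v, μ v ≠ 1 := by
  have hdiv : 0 ≤ ∑ v, μ v / 2 := sum_nonneg fun v _ => Int.ediv_nonneg (hμ v) zero_le_two
  have hmod := sum_emod_two_eq_zero_or_three_le h0 heven
  have hsum := sum_eq_two_mul_sum_div_add_sum_mod μ
  omega

theorem ne_three_of_sum_eq_four (h0 : μ 0 = 0) (hμ : ∀ v, 0 ≤ μ v)
    (heven : ∀ q, Even (mass μ q)) (hsum : ∑ v, μ v = 4) (v : Vec s) : μ v ≠ 3 := by
  have hdiv : μ v / 2 ≤ ∑ v, μ v / 2 :=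
    single_le_sum (f := fun v => μ v / 2) (fun v _ => Int.ediv_nonneg (hμ v) zero_le_two)
      (mem_univ v)
  have hmod : μ v % 2 ≤ ∑ v, μ v % 2 :=
    single_le_sum (f := fun v => μ v % 2) (fun v _ => Int.emod_nonneg (μ v) two_ne_zero)
      (mem_univ v)
  have hmod' := sum_emod_two_eq_zero_or_three_le h0 heven
  have hsum' := sum_eq_two_mul_sum_div_add_sum_mod μ
  omega

theorem sum_sq_lt_of_even_mass (h0 : μ 0 = 0) (hμ : ∀ v, 0 ≤ μ v) (hμ2 : ∀ v, μ v ≤ 2)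
    (heven : ∀ q, Even (mass μ q)) (hge : 2 ≤ ∑ v, μ v) (hle : ∑ v, μ v ≤ 5) :
    ∑ v, μ v ^ 2 < 8 * ∑ v, μ v - (∑ v, μ v) ^ 2 - 6 := by
  have hsq := sum_sq_eq_four_mul_sum_div_add_sum_mod hμ hμ2
  have hmod := sum_emod_two_eq_zero_or_three_le h0 heven
  have hsum := sum_eq_two_mul_sum_div_add_sum_mod μ
  generalize ∑ v, μ v = total at *
  interval_cases total <;> omega

end EvenMass

/-! ### Residual codes -/

section Residual

variable {s : ℕ} {μ : Vec s → ℤ} {e p : Vec s}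

/-- The part of `μ` on the hyperplane orthogonal to `e`: the columns of the residual code of the
code with column multiset `μ` with respect to the codeword with coefficient vector `e`. -/
def residual (μ : Vec s → ℤ) (e v : Vec s) : ℤ := μ v * (1 - ind v e)

/-- The part of `μ` off the hyperplane orthogonal to `e`, without the vector `p`: the support of
the codeword with coefficient vector `e`, punctured at all columns equal to `p`. -/
def puncturedSupport (μ : Vec s → ℤ) (e p v : Vec s) : ℤ := if v = p then 0 else μ v * ind v e

theorem residual_nonneg (hμ : ∀ v, 0 ≤ μ v) (e v : Vec s) : 0 ≤ residual μ e v :=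
  mul_nonneg (hμ v) (sub_nonneg.2 (ind_le_one v e))

theorem residual_le (hμ : ∀ v, 0 ≤ μ v) (e v : Vec s) : residual μ e v ≤ μ v :=
  mul_le_of_le_one_right (hμ v) (sub_le_self 1 (ind_nonneg v e))

theorem residual_zero (h0 : μ 0 = 0) (e : Vec s) : residual μ e 0 = 0 := by simp [residual, h0]

theorem residual_of_ind_eq_zero {v : Vec s} (hv : ind v e = 0) : residual μ e v = μ v := by
  simp [residual, hv]

theorem sum_residual (μ : Vec s → ℤ) (e : Vec s) :
    ∑ v, residual μ e v = ∑ v, μ v - mass μ e := by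
  simp only [residual, mul_sub, mul_one, sum_sub_distrib, mass]

theorem two_mul_mass_residual (μ : Vec s → ℤ) (e q : Vec s) :
    2 * mass (residual μ e) q = mass μ q + mass μ (q + e) - mass μ e := by
  simp only [mass, mul_sum, ← sum_add_distrib, ← sum_sub_distrib]
  exact sum_congr rfl fun v _ => by rw [ind_add_right, residual]; ring

theorem even_mass_residual (hdvd : ∀ q, 4 ∣ mass μ q) (e q : Vec s) :
    Even (mass (residual μ e) q) := by
  have htwo := two_mul_mass_residual μ e q
  obtain ⟨a, ha⟩ := hdvd q
  obtain ⟨b, hb⟩ := hdvd (q + e)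
  obtain ⟨c, hc⟩ := hdvd e
  exact ⟨a + b - c, by omega⟩

theorem sum_ne_mass_add_one (h0 : μ 0 = 0) (hμ : ∀ v, 0 ≤ μ v) (hdvd : ∀ q, 4 ∣ mass μ q)
    (e : Vec s) : ∑ v, μ v ≠ mass μ e + 1 := by
  have hres := sum_ne_one_of_even_mass (residual_zero h0 e) (residual_nonneg hμ e)
    (even_mass_residual hdvd e)
  rw [sum_residual] at hres
  omega

theorem puncturedSupport_nonneg (hμ : ∀ v, 0 ≤ μ v) (e p v : Vec s) :
    0 ≤ puncturedSupport μ e p v := by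
  unfold puncturedSupport
  split_ifs
  · exact le_rfl
  · exact mul_nonneg (hμ v) (ind_nonneg v e)

theorem sum_puncturedSupport (μ : Vec s → ℤ) (hpe : ind p e = 1) :
    ∑ v, puncturedSupport μ e p v = mass μ e - μ p := by
  have h (v : Vec s) : puncturedSupport μ e p v =
      μ v * ind v e - if v = p then μ p else 0 := by
    unfold puncturedSupport
    split_ifs with hv <;> simp [hv, hpe]
  simp [h, sum_sub_distrib, mass]

theorem two_mul_mass_puncturedSupport (μ : Vec s → ℤ) {q : Vec s} (hpq : ind p q = 0) :
    2 * mass (puncturedSupport μ e p) q = mass μ q - mass μ (q + e) + mass μ e := by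
  simp only [mass, mul_sum, ← sum_add_distrib, ← sum_sub_distrib]
  refine sum_congr rfl fun v _ => ?_
  rw [ind_add_right, puncturedSupport]
  split_ifs with hv
  · rw [hv, hpq]; ring
  · ring

theorem ind_ne_ind_of_add_eq {v w : Vec s} (hpe : ind p e = 1) (hvw : v + w = p) :
    ind v e ≠ ind w e := by
  rintro h
  rw [← hvw, ind_add_left, h] at hpe
  rcases ind_eq_zero_or_one w e with hw | hw <;> simp [hw] at hpe

theorem residual_mul_residual_eq_zero (hpe : ind p e = 1) {v w : Vec s} (hvw : v + w = p) :
    residual μ e v * residual μ e w = 0 := by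
  have hne := ind_ne_ind_of_add_eq hpe hvw
  unfold residual
  rcases ind_eq_zero_or_one v e with hv | hv <;> rcases ind_eq_zero_or_one w e with hw | hw <;>
    simp_all

theorem puncturedSupport_mul_puncturedSupport_eq_zero (hpe : ind p e = 1) {v w : Vec s}
    (hvw : v + w = p) : puncturedSupport μ e p v * puncturedSupport μ e p w = 0 := by
  have hne := ind_ne_ind_of_add_eq hpe hvw
  unfold puncturedSupport
  rcases ind_eq_zero_or_one v e with hv | hv <;> rcases ind_eq_zero_or_one w e with hw | hw <;>
    simp_all

/- With `a = mass μ q` and `b = mass μ (q + e)` the two masses are `(a - b) / 2 + 4` and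
`(a + b) / 2 - 4`, both even, and their sum `a` is divisible by four. -/
theorem mass_puncturedSupport_sq_sub_eq_mass_residual_sq_sub (hμ : ∀ v, 0 ≤ μ v)
    (hdvd : ∀ q, 4 ∣ mass μ q) (hmass : mass μ e = 8) (hsum : ∑ v, μ v ≤ 13) {q : Vec s}
    (hpq : ind p q = 0) (hle : mass μ q ≤ mass μ (q + e)) :
    mass (puncturedSupport μ e p) q ^ 2 - 4 * mass (puncturedSupport μ e p) q =
      mass (residual μ e) q ^ 2 - 4 * mass (residual μ e) q := by
  have hpunct := two_mul_mass_puncturedSupport (e := e) μ hpq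
  have hres := two_mul_mass_residual μ e q
  have hpunct0 := mass_nonneg (puncturedSupport_nonneg hμ e p) q
  have hres0 := mass_nonneg (residual_nonneg hμ e) q
  have hres5 := mass_le_sum (residual_nonneg hμ e) q
  rw [sum_residual] at hres5
  obtain ⟨a, ha⟩ := hdvd q
  obtain ⟨b, hb⟩ := hdvd (q + e)
  generalize mass (puncturedSupport μ e p) q = x at *
  generalize mass (residual μ e) q = y at *
  have hx : x = 0 ∨ x = 2 ∨ x = 4 := by omega
  have hy : y = 0 ∨ y = 2 ∨ y = 4 := by omega
  have hdiff : x = 2 ↔ y = 2 := by omega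
  rcases hx with rfl | rfl | rfl <;> rcases hy with rfl | rfl | rfl <;>
    first | rfl | omega

theorem le_sum_residual_sq (h0 : μ 0 = 0) (hμ : ∀ v, 0 ≤ μ v) (hdvd : ∀ q, 4 ∣ mass μ q)
    (hpe : ind p e = 1) (hp : μ p = 2) (hmass : mass μ e = 8) (hsum : ∑ v, μ v ≤ 13)
    (hle : ∀ q, ind p q = 0 → mass μ q ≤ mass μ (q + e)) :
    8 * ∑ v, residual μ e v - (∑ v, residual μ e v) ^ 2 - 6 ≤ ∑ v, residual μ e v ^ 2 := by
  have hp0 : p ≠ 0 := by rintro rfl; simp at hpe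
  have hpunct := eight_mul_sum_orthogonal_mass (μ := puncturedSupport μ e p) hp0
    (by simp [puncturedSupport, h0]) (by simp [puncturedSupport])
    fun v w => puncturedSupport_mul_puncturedSupport_eq_zero hpe
  have hres := eight_mul_sum_orthogonal_mass (μ := residual μ e) hp0 (residual_zero h0 e)
    (by simp [residual, hpe]) fun v w => residual_mul_residual_eq_zero hpe
  have heq : ∑ q, (1 - ind p q) *
        (mass (puncturedSupport μ e p) q ^ 2 - 4 * mass (puncturedSupport μ e p) q) =
      ∑ q, (1 - ind p q) * (mass (residual μ e) q ^ 2 - 4 * mass (residual μ e) q) := by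
    refine sum_congr rfl fun q _ => ?_
    rcases ind_eq_zero_or_one p q with hpq | hpq
    · rw [mass_puncturedSupport_sq_sub_eq_mass_residual_sq_sub hμ hdvd hmass hsum hpq (hle q hpq)]
    · simp [hpq]
  rw [heq, hres] at hpunct
  have hmoments := mul_left_cancel₀ (pow_ne_zero s two_ne_zero) hpunct
  have hlower := sum_le_sum_sq (puncturedSupport μ e p)
  rw [sum_puncturedSupport μ hpe, hmass, hp] at hmoments hlower
  linarith

end Residual

/-! ### Possible totals of the excess multiset -/

section Recoverable

/-- The conditions that the recovery sets of a PIR code impose on the multiplicity function `δ` of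
its excess multiset (see `excess`): all masses are divisible by `Δ`, and those at the unit vectors
satisfy two inequalities, of which the second one is the first one modulo the span of `q`. -/
structure IsRecoverable {s : ℕ} (Δ : ℤ) (δ : Vec s → ℤ) : Prop where
  zero : δ 0 = 0
  nonneg (v : Vec s) : 0 ≤ δ v
  dvd_mass (q : Vec s) : Δ ∣ mass δ q
  mul_le_mass {i : Fin s} {v : Vec s} (hv : v i = 1) : Δ * δ v ≤ mass δ (Pi.single i 1)
  mul_add_mass_le {i : Fin s} {v q : Vec s} (hv : v i = 1) (hq : v ⬝ᵥ q = 0) :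
    Δ * δ v + mass δ q ≤ mass δ (Pi.single i 1) + mass δ (Pi.single i 1 + q)

namespace IsRecoverable

theorem exists_mul_le_mass {s : ℕ} {Δ : ℤ} {δ : Vec s → ℤ} (h : IsRecoverable Δ δ) {v : Vec s}
    (hv : δ v ≠ 0) : ∃ q, Δ * δ v ≤ mass δ q := by
  obtain ⟨i, hi⟩ := exists_apply_eq_one (v := v) (by rintro rfl; exact hv h.zero)
  exact ⟨Pi.single i 1, h.mul_le_mass hi⟩

section

variable {s : ℕ} {δ : Vec s → ℤ}

theorem mass_le_eight (h : IsRecoverable 4 δ) (hsum : ∑ v, δ v ≤ 13) (h12 : ∑ v, δ v ≠ 12)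
    (q : Vec s) : mass δ q ≤ 8 := by
  have hle := mass_le_sum h.nonneg q
  have hne := sum_ne_mass_add_one h.zero h.nonneg h.dvd_mass q
  have hdvd := h.dvd_mass q
  omega

theorem le_two (h : IsRecoverable 4 δ) (hsum : ∑ v, δ v ≤ 13) (h12 : ∑ v, δ v ≠ 12)
    (v : Vec s) : δ v ≤ 2 := by
  by_contra! hv
  obtain ⟨q, hq⟩ := h.exists_mul_le_mass (v := v) (by omega)
  have hmass := h.mass_le_eight hsum h12 q
  omega

theorem le_three (h : IsRecoverable 4 δ) (hsum : ∑ v, δ v ≤ 13) (v : Vec s) : δ v ≤ 3 := by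
  by_contra! hv
  obtain ⟨q, hq⟩ := h.exists_mul_le_mass (v := v) (by omega)
  have hmass := mass_le_sum h.nonneg q
  omega

theorem residual_le_two (h : IsRecoverable 4 δ) (hsum : ∑ v, δ v ≤ 13) {e : Vec s}
    (hmass : mass δ e = 8) (v : Vec s) : residual δ e v ≤ 2 := by
  have hle := residual_le h.nonneg e v
  by_cases h12 : ∑ v, δ v = 12
  · have hne := ne_three_of_sum_eq_four (residual_zero h.zero e) (residual_nonneg h.nonneg e)
      (even_mass_residual h.dvd_mass e) (by rw [sum_residual]; omega) v
    have hle3 := h.le_three hsum v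
    omega
  · exact hle.trans (h.le_two hsum h12 v)

theorem false_of_apply_eq_one_of_apply_eq_zero (h : IsRecoverable 4 δ)
    (hsum : ∑ v, δ v ≤ 13) {p p' : Vec s} (hp : 2 ≤ δ p) (hp' : 2 ≤ δ p') {i : Fin s}
    (hpi : p i = 1) (hpi' : p' i = 0) : False := by
  set e : Vec s := Pi.single i 1 with he
  have hpe : ind p e = 1 := ind_eq_one_iff.2 (by simpa [he] using hpi)
  have hpe' : ind p' e = 0 := ind_eq_zero_iff.2 (by simpa [he] using hpi')
  have hres : δ p' ≤ ∑ v, residual δ e v :=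
    (residual_of_ind_eq_zero hpe').ge.trans
      (single_le_sum (fun v _ => residual_nonneg h.nonneg e v) (mem_univ p'))
  have hsumres := sum_residual δ e
  have hpmass : 4 * δ p ≤ mass δ e := h.mul_le_mass hpi
  have hmass : mass δ e = 8 := by
    have hdvd := h.dvd_mass e
    omega
  have hp2 : δ p = 2 := by omega
  have hlower := le_sum_residual_sq h.zero h.nonneg h.dvd_mass hpe hp2 hmass hsum fun q hq => by
    have hrec : 4 * δ p + mass δ q ≤ mass δ e + mass δ (e + q) :=
      h.mul_add_mass_le hpi (ind_eq_zero_iff.1 hq)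
    rw [add_comm e q] at hrec
    omega
  have hupper := sum_sq_lt_of_even_mass (residual_zero h.zero e) (residual_nonneg h.nonneg e)
    (h.residual_le_two hsum hmass) (even_mass_residual h.dvd_mass e) (by omega) (by omega)
  omega

theorem eq_of_two_le (h : IsRecoverable 4 δ) (hsum : ∑ v, δ v ≤ 13) {p p' : Vec s}
    (hp : 2 ≤ δ p) (hp' : 2 ≤ δ p') : p = p' := by
  ext i
  rcases zmod_two_eq_zero_or_one (p i) with hi | hi <;>
    rcases zmod_two_eq_zero_or_one (p' i) with hi' | hi'
  · rw [hi, hi']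
  · exact (h.false_of_apply_eq_one_of_apply_eq_zero hsum hp' hp hi' hi).elim
  · exact (h.false_of_apply_eq_one_of_apply_eq_zero hsum hp hp' hi hi').elim
  · rw [hi, hi']

end

section

variable {δ : Vec 5 → ℤ}

theorem sum_notMem_Icc_one_six (h : IsRecoverable 4 δ) : ∑ v, δ v ∉ Set.Icc 1 6 := by
  rintro ⟨hge, hle⟩
  have hsq := mul_sub_sum_sq_le_of_dvd_mass h.zero h.dvd_mass 0
  obtain ⟨p, hp⟩ := exists_two_le_of_sum_lt_sum_sq h.nonneg (by nlinarith)
  obtain ⟨q, hq⟩ := h.exists_mul_le_mass (v := p) (by omega)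
  have hmass := mass_le_sum h.nonneg q
  omega

theorem sum_ne_nine (h : IsRecoverable 4 δ) : ∑ v, δ v ≠ 9 := fun hsum => by
  have hsq := mul_sub_sum_sq_le_of_dvd_mass h.zero h.dvd_mass 1
  rw [hsum] at hsq
  obtain ⟨p, hp⟩ := exists_two_le_of_sum_lt_sum_sq h.nonneg (by omega)
  obtain ⟨q, hq⟩ := h.exists_mul_le_mass (v := p) (by omega)
  have hle := mass_le_sum h.nonneg q
  have hne := sum_ne_mass_add_one h.zero h.nonneg h.dvd_mass q
  have hdvd := h.dvd_mass q
  omega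

theorem sum_notMem_Icc_ten_thirteen (h : IsRecoverable 4 δ) : ∑ v, δ v ∉ Set.Icc 10 13 := by
  rintro ⟨hge, hle⟩
  have hsq := mul_sub_sum_sq_le_of_dvd_mass h.zero h.dvd_mass 1
  obtain ⟨p, p', hne, hp, hp'⟩ : ∃ p p', p ≠ p' ∧ 2 ≤ δ p ∧ 2 ≤ δ p' := by
    by_cases h12 : ∑ v, δ v = 12
    · refine exists_ne_two_le_of_sum_add_lt_sum_sq h.nonneg (h.le_three hle) ?_
      rw [h12] at hsq ⊢
      omega
    · refine exists_ne_two_le_of_sum_add_lt_sum_sq h.nonneg (h.le_two hle h12) ?_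
      generalize ∑ v, δ v = D at *
      interval_cases D <;> omega
  exact hne (h.eq_of_two_le hle hp hp')

theorem sum_eq_or_fourteen_le (h : IsRecoverable 4 δ) :
    ∑ v, δ v = 0 ∨ ∑ v, δ v = 7 ∨ ∑ v, δ v = 8 ∨ 14 ≤ ∑ v, δ v := by
  have hnonneg : 0 ≤ ∑ v, δ v := sum_nonneg fun v _ => h.nonneg v
  have hsmall := h.sum_notMem_Icc_one_six
  have hnine := h.sum_ne_nine
  have hlarge := h.sum_notMem_Icc_ten_thirteen
  rw [Set.mem_Icc] at hsmall hlarge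
  omega

end

end IsRecoverable

end Recoverable

/-! ### Packings of recovery sets -/

section Packing

section AddCommMonoid

variable {ι κ M : Type*} [AddCommMonoid M] {c : ι → M} {d : κ → M} {k l : ℕ} {e : M}

/-- The family `c` contains `k` pairwise disjoint subfamilies with sum `e`. -/
def Packing (c : ι → M) (k : ℕ) (e : M) : Prop :=
  ∃ R : Fin k → Finset ι, (∀ j j', j ≠ j' → Disjoint (R j) (R j')) ∧ ∀ j, ∑ h ∈ R j, c h = e

theorem Packing.of_fintype {α : Type*} [Fintype α] (hcard : Fintype.card α = k)
    (R : α → Finset ι) (hR : ∀ a b, a ≠ b → Disjoint (R a) (R b))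
    (hsum : ∀ a, ∑ h ∈ R a, c h = e) : Packing c k e :=
  let σ := (Fintype.equivFinOfCardEq hcard).symm
  ⟨R ∘ σ, fun j j' hj => hR (σ j) (σ j') (σ.injective.ne hj), fun j => hsum (σ j)⟩

theorem Packing.map (h : Packing c k e) (f : ι ↪ κ) (hf : ∀ j, d (f j) = c j) :
    Packing d k e := by
  obtain ⟨R, hR, hsum⟩ := h
  exact ⟨fun j => (R j).map f, fun j j' hj => (disjoint_map f).2 (hR j j' hj),
    fun j => by simp only [sum_map, hf, hsum]⟩

theorem Packing.sumElim (hc : Packing c k e) (hd : Packing d l e) :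
    Packing (Sum.elim c d) (k + l) e := by
  obtain ⟨R, hR, hsum⟩ := hc
  obtain ⟨R', hR', hsum'⟩ := hd
  have hdisj (j : Fin k) (j' : Fin l) : Disjoint ((R j).map (.inl : ι ↪ ι ⊕ κ))
      ((R' j').map .inr) :=
    disjoint_map_inl_map_inr _ _
  refine .of_fintype (α := Fin k ⊕ Fin l) (by simp)
    (Sum.elim (fun j => (R j).map .inl) fun j => (R' j).map .inr) ?_ ?_
  · rintro (a | a) (b | b) hab
    · exact (disjoint_map _).2 (hR a b (Sum.inl_injective.ne_iff.1 hab))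
    · exact hdisj a b
    · exact (hdisj b a).symm
    · exact (disjoint_map _).2 (hR' a b (Sum.inr_injective.ne_iff.1 hab))
  · rintro (a | a) <;> simp [hsum, hsum']

theorem Packing.mul_le_sum [Fintype ι] (h : Packing c k e) {w : M → ℕ} (hw0 : w 0 = 0)
    (hw : ∀ a b, w (a + b) ≤ w a + w b) : k * w e ≤ ∑ j, w (c j) := by
  classical
  obtain ⟨R, hR, hsum⟩ := h
  calc k * w e = ∑ j, w (∑ h ∈ R j, c h) := by simp [hsum]
    _ ≤ ∑ j, ∑ h ∈ R j, w (c h) :=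
        sum_le_sum fun j _ => le_sum_of_subadditive w hw0.le hw _ _
    _ = ∑ h ∈ univ.biUnion R, w (c h) := (sum_biUnion fun j _ j' _ hj => hR j j' hj).symm
    _ ≤ ∑ h, w (c h) := sum_le_sum_of_subset (subset_univ _)

theorem Packing.update [DecidableEq ι] (h : Packing c (k + 1) e) (j₀ : ι) (x : M) :
    Packing (Function.update c j₀ x) k e := by
  obtain ⟨R, hR, hsum⟩ := h
  obtain ⟨a, ha⟩ : ∃ a, ∀ j, j ≠ a → j₀ ∉ R j := by
    by_cases hj₀ : ∃ a, j₀ ∈ R a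
    · obtain ⟨a, ha⟩ := hj₀
      exact ⟨a, fun j hj hmem => disjoint_left.1 (hR j a hj) hmem ha⟩
    · exact ⟨0, fun j _ hmem => hj₀ ⟨j, hmem⟩⟩
  refine ⟨R ∘ a.succAbove, fun j j' hj => hR _ _ (a.succAbove_right_injective.ne hj),
    fun j => ?_⟩
  rw [← hsum (a.succAbove j), Function.comp_apply]
  refine sum_congr rfl fun h hh => Function.update_of_ne ?_ _ _
  rintro rfl
  exact ha _ (a.succAbove_ne j) hh

theorem Packing.replace_zero [DecidableEq M] (h : Packing c k e) (x : M) :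
    Packing (fun j => if c j = 0 then x else c j) k e := by
  obtain ⟨R, hR, hsum⟩ := h
  refine ⟨fun j => {h ∈ R j | c h ≠ 0}, fun j j' hj => disjoint_filter_filter (hR j j' hj),
    fun j => ?_⟩
  rw [← hsum j, ← sum_filter_ne_zero (R j)]
  exact sum_congr rfl fun h hh => if_neg (mem_filter.1 hh).2

end AddCommMonoid

section Module

variable {ι V : Type*} [AddCommGroup V] [Module (ZMod 2) V] {c : ι → V} {k : ℕ} {e e' : V}

theorem nsmul_eq_zero_or_self_of_zmod_two (m : ℕ) (v : V) : m • v = 0 ∨ m • v = v := by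
  rw [← Nat.cast_smul_eq_nsmul (ZMod 2)]
  rcases zmod_two_eq_zero_or_one m with h | h <;> simp [h]

theorem nsmul_eq_self_of_odd {m : ℕ} (hm : Odd m) (v : V) : m • v = v := by
  rw [← Nat.cast_smul_eq_nsmul (ZMod 2), hm.natCast_zmod_two, one_smul]

/- The columns outside the given recovery sets form one more recovery set. -/
theorem Packing.succ_of_sum_eq_zero [Fintype ι] (hk : Odd k) (hc : ∑ j, c j = 0)
    (h : Packing c k e) : Packing c (k + 1) e := by
  classical
  obtain ⟨R, hR, hsum⟩ := h
  have hunion : ∑ j ∈ univ.biUnion R, c j = e := by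
    rw [sum_biUnion fun j _ j' _ hj => hR j j' hj, sum_congr rfl fun j _ => hsum j, sum_const,
      card_univ, Fintype.card_fin, nsmul_eq_self_of_odd hk]
  have hcompl : ∑ j ∈ (univ.biUnion R)ᶜ, c j = e := by
    rw [← sum_add_sum_compl (univ.biUnion R), hunion, add_eq_zero_iff_eq_of_zmod_two] at hc
    exact hc.symm
  have hdisj (j : Fin k) : Disjoint (R j) (univ.biUnion R)ᶜ :=
    disjoint_compl_right.mono_left (subset_biUnion_of_mem R (mem_univ j))
  refine ⟨Fin.cons (univ.biUnion R)ᶜ R, fun j j' => ?_, Fin.cases hcompl hsum⟩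
  refine Fin.cases ?_ (fun a => ?_) j <;> refine Fin.cases ?_ (fun b => ?_) j' <;> intro hj
  · exact absurd rfl hj
  · exact (hdisj b).symm
  · exact hdisj a
  · exact hR a b fun hab => hj (congrArg Fin.succ hab)

theorem sum_update_sum_erase [Fintype ι] [DecidableEq ι] (c : ι → V) (j₀ : ι) :
    ∑ j, Function.update c j₀ (∑ j ∈ univ.erase j₀, c j) j = 0 := by
  rw [sum_update_of_mem (mem_univ j₀), sdiff_singleton_eq_erase, add_eq_zero_iff_eq_of_zmod_two]

theorem exists_sum_erase_ne_zero [Fintype ι] [DecidableEq ι] (hk : 0 < k) (he : e ≠ 0)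
    (he' : e' ≠ 0) (hne : e ≠ e') (h : Packing c k e) (h' : Packing c k e') :
    ∃ j₀, ∑ j ∈ univ.erase j₀, c j ≠ 0 := by
  by_contra! hzero
  have hconst (j : ι) : c j = ∑ j, c j := by
    rw [← add_sum_erase _ _ (mem_univ j), hzero j, add_zero]
  have hall {x : V} (hx : x ≠ 0) (hpack : Packing c k x) : x = ∑ j, c j := by
    obtain ⟨R, -, hsum⟩ := hpack
    rw [← hsum ⟨0, hk⟩, sum_congr rfl fun j _ => hconst j, sum_const] at hx ⊢
    exact (nsmul_eq_zero_or_self_of_zmod_two _ _).resolve_left hx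
  exact hne ((hall he h).trans (hall he' h').symm)

end Module

end Packing

section PIRFamily

variable {ι : Type*} {s k n : ℕ} {c : ι → Vec s}

/-- The family `c` is the family of columns of a generator matrix of a `k`-PIR code. -/
def PIRFamily (c : ι → Vec s) (k : ℕ) : Prop :=
  ∀ i, Packing c k (Pi.single i 1)

theorem PIRFamily.exists_fin [Fintype ι] (h : PIRFamily c k) (hn : Fintype.card ι = n) :
    ∃ d : Fin n → Vec s, PIRFamily d k :=
  let σ := Fintype.equivFinOfCardEq hn
  ⟨c ∘ σ.symm, fun i => (h i).map σ.toEmbedding fun j => by simp⟩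

theorem PIRFamily.eq_zero_of_dotProduct_eq_zero (hk : 0 < k) (h : PIRFamily c k) {g : Vec s}
    (hg : ∀ j, g ⬝ᵥ c j = 0) : g = 0 := by
  ext i
  obtain ⟨R, -, hR⟩ := h i
  calc g i = g ⬝ᵥ ∑ j ∈ R ⟨0, hk⟩, c j := by simp [hR]
    _ = 0 := by rw [dotProduct_sum]; exact sum_eq_zero fun j _ => hg j

theorem exists_isPIRCode_iff (hk : 0 < k) :
    (∃ C, IsPIRCode n s k C) ↔ ∃ c : Fin n → Vec s, PIRFamily c k := by
  constructor
  · rintro ⟨C, G, -, h⟩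
    exact ⟨G.col, h⟩
  · rintro ⟨c, hc⟩
    refine ⟨_, Matrix.of fun i j => c j i, ⟨Fintype.linearIndependent_iff.2 fun g hg => ?_, rfl⟩,
      hc⟩
    refine congrFun (hc.eq_zero_of_dotProduct_eq_zero hk fun j => ?_)
    simpa [dotProduct, Finset.sum_apply] using congrFun hg j

/- Replacing a column by the sum of the others costs at most one recovery set, and
`Packing.succ_of_sum_eq_zero` restores it. -/
theorem PIRFamily.exists_normalized [Fintype ι] [Nontrivial (Fin s)] (hk : Even k) (hk0 : 0 < k)
    (h : PIRFamily c k) :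
    ∃ d : ι → Vec s, PIRFamily d k ∧ (∀ j, d j ≠ 0) ∧ ∑ j, d j = 0 := by
  classical
  obtain ⟨i, i', hi⟩ := exists_pair_ne (Fin s)
  have hunit (i : Fin s) : (Pi.single i 1 : Vec s) ≠ 0 := by simp
  obtain ⟨c', hc', hne⟩ : ∃ c' : ι → Vec s, PIRFamily c' k ∧ ∀ j, c' j ≠ 0 := by
    refine ⟨_, fun i' => (h i').replace_zero (Pi.single i 1), fun j => ?_⟩
    split_ifs with hj
    · exact hunit i
    · exact hj
  obtain ⟨j₀, hj₀⟩ := exists_sum_erase_ne_zero hk0 (hunit i) (hunit i')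
    (fun heq => hi (by simpa [Pi.single_apply, eq_comm] using congrFun heq i)) (hc' i) (hc' i')
  refine ⟨Function.update c' j₀ (∑ j ∈ univ.erase j₀, c' j), fun i => ?_, fun j => ?_,
    sum_update_sum_erase c' j₀⟩
  · obtain ⟨l, rfl⟩ := Nat.exists_eq_add_one_of_ne_zero hk0.ne'
    have hl : Odd l := Nat.not_even_iff_odd.1 (Nat.even_add_one.1 hk)
    exact ((hc' i).update j₀ _).succ_of_sum_eq_zero hl (sum_update_sum_erase c' j₀)
  · rcases eq_or_ne j j₀ with rfl | hj
    · rwa [Function.update_self]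
    · rw [Function.update_of_ne hj]
      exact hne j

end PIRFamily

/-! ### The excess multiset of a PIR code -/

section Cover

variable {ι : Type*} {s k : ℕ} {v e a b : Vec s} {Q : Submodule (ZMod 2) (Vec s)}

open Classical in
/-- For `v ⬝ᵥ e = 1` and `Q` orthogonal to `v`: roughly, the number of vectors `x` with
`v ⬝ᵥ x = 1`, other than `e`, that are needed to write `h` as a sum modulo `Q`. It is the
subadditive weight by which recovery sets of `e` are counted. -/
noncomputable def cover (v e : Vec s) (Q : Submodule (ZMod 2) (Vec s)) (h : Vec s) : ℕ :=
  if h ∈ Q then 0 else if h + e ∈ Q then 3 else if v ⬝ᵥ h = 1 then 1 else 2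

theorem cover_zero : cover v e Q 0 = 0 := if_pos Q.zero_mem

theorem cover_self (he : v ⬝ᵥ e = 1) (hQ : ∀ x ∈ Q, v ⬝ᵥ x = 0) : cover v e Q e = 3 := by
  have heQ : e ∉ Q := fun h => by simpa [he] using hQ e h
  simp [cover, heQ, ZModModule.add_self]

theorem cover_add_of_mem_left (hQ : ∀ x ∈ Q, v ⬝ᵥ x = 0) (ha : a ∈ Q) :
    cover v e Q (a + b) = cover v e Q b := by
  classical
  have hmem (x : Vec s) : a + x ∈ Q ↔ x ∈ Q := Q.add_mem_iff_right ha
  simp only [cover, add_assoc, hmem, dotProduct_add, hQ a ha, zero_add]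

theorem one_le_cover (ha : a ∉ Q) : 1 ≤ cover v e Q a := by
  rw [cover, if_neg ha]
  split_ifs <;> norm_num

theorem two_le_cover (ha : a ∉ Q) (hva : v ⬝ᵥ a = 0) : 2 ≤ cover v e Q a := by
  rw [cover, if_neg ha, if_neg (c := v ⬝ᵥ a = 1) (by simp [hva])]
  split_ifs <;> norm_num

theorem cover_le_three (v e a : Vec s) (Q : Submodule (ZMod 2) (Vec s)) : cover v e Q a ≤ 3 := by
  unfold cover
  split_ifs <;> norm_num

theorem cover_le_two (ha : a + e ∉ Q) : cover v e Q a ≤ 2 := by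
  rw [cover, if_neg ha]
  split_ifs <;> norm_num

theorem cover_add_le (he : v ⬝ᵥ e = 1) (hQ : ∀ x ∈ Q, v ⬝ᵥ x = 0) (a b : Vec s) :
    cover v e Q (a + b) ≤ cover v e Q a + cover v e Q b := by
  by_cases ha : a ∈ Q
  · rw [cover_add_of_mem_left hQ ha]; exact Nat.le_add_left _ _
  by_cases hb : b ∈ Q
  · rw [add_comm a, cover_add_of_mem_left hQ hb]; exact Nat.le_add_right _ _
  have ha1 : 1 ≤ cover v e Q a := one_le_cover ha
  have hb1 : 1 ≤ cover v e Q b := one_le_cover hb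
  by_cases hab : a + b + e ∈ Q
  · have hle := cover_le_three v e (a + b) Q
    rcases zmod_two_eq_zero_or_one (v ⬝ᵥ a) with hva | hva
    · have ha2 : 2 ≤ cover v e Q a := two_le_cover ha hva
      omega
    · have hvb : v ⬝ᵥ b = 0 := by
        have hsum := hQ _ hab
        rw [dotProduct_add, dotProduct_add, hva, he, add_right_comm, CharTwo.add_self_eq_zero,
          zero_add] at hsum
        exact hsum
      have hb2 : 2 ≤ cover v e Q b := two_le_cover hb hvb
      omega
  · have hle : cover v e Q (a + b) ≤ 2 := cover_le_two hab
    omega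

open Classical in
theorem cover_add_ite (he : v ⬝ᵥ e = 1) (hQ : ∀ x ∈ Q, v ⬝ᵥ x = 0) (h : Vec s) :
    cover v e Q h + (if v ⬝ᵥ h = 1 then 1 else 0) + 2 * (if h ∈ Q then 1 else 0) =
      2 + 2 * (if h + e ∈ Q then 1 else 0) := by
  by_cases hmem : h ∈ Q
  · have heQ : h + e ∉ Q := fun h' => by
      simpa [he] using hQ e ((Q.add_mem_iff_right hmem).1 h')
    simp [cover, hmem, heQ, hQ h hmem]
  by_cases hmem' : h + e ∈ Q
  · have hvh : v ⬝ᵥ h = 1 := by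
      have hsum := hQ _ hmem'
      rwa [dotProduct_add, he, CharTwo.add_eq_zero] at hsum
    simp [cover, hmem, hmem', hvh]
  · simp only [cover, hmem, hmem', if_false]
    split_ifs <;> rfl

open Classical in
theorem Packing.three_mul_add_card_le [Fintype ι] {d : ι → Vec s} (h : Packing d k e)
    (he : v ⬝ᵥ e = 1) (hQ : ∀ x ∈ Q, v ⬝ᵥ x = 0) :
    3 * k + #{j | v ⬝ᵥ d j = 1} + 2 * #{j | d j ∈ Q} ≤
      2 * Fintype.card ι + 2 * #{j | d j + e ∈ Q} := by
  have hle := h.mul_le_sum cover_zero (cover_add_le he hQ)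
  rw [cover_self he hQ] at hle
  have hsum := Fintype.sum_congr _ _ fun j => cover_add_ite he hQ (d j)
  simp only [sum_add_distrib, ← mul_sum, sum_boole, Nat.cast_id, sum_const, card_univ,
    smul_eq_mul] at hsum
  omega

theorem Packing.le_card_dotProduct_eq_one [Fintype ι] {d : ι → Vec s} (h : Packing d k e)
    (he : v ⬝ᵥ e = 1) : k ≤ #{j | v ⬝ᵥ d j = 1} := by
  have hle := h.mul_le_sum (w := fun x => if v ⬝ᵥ x = 1 then 1 else 0) (by simp) fun a b => by
    rw [dotProduct_add]
    rcases zmod_two_eq_zero_or_one (v ⬝ᵥ a) with ha | ha <;>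
      rcases zmod_two_eq_zero_or_one (v ⬝ᵥ b) with hb | hb <;> rw [ha, hb] <;> decide
  simpa [he] using hle

end Cover

section Excess

variable {ι : Type*} [Fintype ι] {s k : ℕ} {d : ι → Vec s}

/-- The weight of the codeword with coefficient vector `v` in the code with columns `d`. -/
def wt (d : ι → Vec s) (v : Vec s) : ℕ := #{j | v ⬝ᵥ d j = 1}

/-- The number of columns equal to `h`. -/
def mult (d : ι → Vec s) (h : Vec s) : ℕ := #{j | d j = h}

theorem natCast_wt (d : ι → Vec s) (v : Vec s) : (wt d v : ℤ) = ∑ j, ind v (d j) :=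
  natCast_card_filter _ _

theorem natCast_mult (d : ι → Vec s) (h : Vec s) :
    (mult d h : ℤ) = ∑ j, if d j = h then 1 else 0 :=
  natCast_card_filter _ _

theorem even_wt (hd : ∑ j, d j = 0) (v : Vec s) : Even (wt d v) := by
  rw [← ZMod.natCast_eq_zero_iff_even]
  calc (wt d v : ZMod 2) = ((∑ j, ind v (d j) : ℤ) : ZMod 2) := by rw [← natCast_wt]; simp
    _ = v ⬝ᵥ ∑ j, d j := by simp only [Int.cast_sum, intCast_ind, dotProduct_sum]
    _ = 0 := by rw [hd, dotProduct_zero]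

theorem two_mul_sum_wt (hd0 : ∀ j, d j ≠ 0) :
    2 * ∑ v, (wt d v : ℤ) = 2 ^ s * Fintype.card ι := by
  simp only [natCast_wt]
  rw [sum_comm, mul_sum]
  simp only [mul_sum, ind_comm _ (d _), two_mul_sum_ind (hd0 _)]
  simp [mul_comm]

theorem four_mul_mass_wt (hd0 : ∀ j, d j ≠ 0) {q : Vec s} (hq : q ≠ 0) :
    4 * mass (fun v => (wt d v : ℤ)) q = 2 ^ s * (Fintype.card ι + mult d q) := by
  simp only [mass, natCast_wt, natCast_mult, sum_mul]
  rw [sum_comm, mul_sum]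
  simp only [mul_sum, ind_comm _ (d _), ind_comm _ q, four_mul_sum_ind_mul_ind (hd0 _) hq]
  simp [← mul_sum, sum_add_distrib]

theorem PIRFamily.le_wt (h : PIRFamily d k) {v : Vec s} (hv : v ≠ 0) : k ≤ wt d v := by
  obtain ⟨i, hi⟩ := exists_apply_eq_one hv
  exact (h i).le_card_dotProduct_eq_one (by simp [hi])

theorem PIRFamily.three_mul_add_wt_le (h : PIRFamily d k) (hd0 : ∀ j, d j ≠ 0) {i : Fin s}
    {v : Vec s} (hv : v i = 1) :
    3 * k + wt d v ≤ 2 * Fintype.card ι + 2 * mult d (Pi.single i 1) := by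
  classical
  have hle := (h i).three_mul_add_card_le (v := v) (Q := ⊥) (by simp [hv]) (by simp)
  simpa [hd0, add_eq_zero_iff_eq_of_zmod_two, wt, mult] using hle

theorem mem_span_singleton_iff_of_zmod_two {q x : Vec s} :
    x ∈ Submodule.span (ZMod 2) {q} ↔ x = 0 ∨ x = q := by
  rw [Submodule.mem_span_singleton]
  constructor
  · rintro ⟨a, rfl⟩
    rcases zmod_two_eq_zero_or_one a with rfl | rfl <;> simp
  · rintro (rfl | rfl)
    · exact ⟨0, zero_smul _ _⟩
    · exact ⟨1, one_smul _ _⟩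

theorem card_filter_eq_or_eq (d : ι → Vec s) {x y : Vec s} (hxy : x ≠ y) :
    #{j | d j = x ∨ d j = y} = mult d x + mult d y := by
  classical
  rw [filter_or, card_union_of_disjoint]
  · rfl
  · exact disjoint_filter.2 fun j _ hj hj' => hxy (hj.symm.trans hj')

theorem PIRFamily.three_mul_add_wt_add_mult_le (h : PIRFamily d k) (hd0 : ∀ j, d j ≠ 0)
    {i : Fin s} {v q : Vec s} (hv : v i = 1) (hvq : v ⬝ᵥ q = 0) (hq : q ≠ 0) :
    3 * k + wt d v + 2 * mult d q ≤
      2 * Fintype.card ι + 2 * (mult d (Pi.single i 1) + mult d (Pi.single i 1 + q)) := by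
  classical
  have hle := (h i).three_mul_add_card_le (v := v) (Q := Submodule.span (ZMod 2) {q})
    (by simp [hv]) fun x hx => by
      rcases mem_span_singleton_iff_of_zmod_two.1 hx with rfl | rfl <;> simp [hvq]
  have hadd (x : Vec s) : x + Pi.single i 1 = q ↔ x = Pi.single i 1 + q := by
    rw [← ZModModule.sub_eq_add x, sub_eq_iff_eq_add, add_comm]
  simp only [mem_span_singleton_iff_of_zmod_two, hd0, false_or, add_eq_zero_iff_eq_of_zmod_two,
    hadd] at hle
  rwa [card_filter_eq_or_eq d (by simpa using hq)] at hle

/-- Half the amount by which the weights of the nonzero codewords exceed `k`, as multiplicities of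
the coefficient vectors. The division is exact if `k` is even and the columns `d` sum to zero. -/
def excess (d : ι → Vec s) (k : ℕ) (v : Vec s) : ℤ := if v = 0 then 0 else (wt d v - k) / 2

theorem excess_zero (d : ι → Vec s) (k : ℕ) : excess d k 0 = 0 := if_pos rfl

theorem two_mul_excess (hk : Even k) (hd : ∑ j, d j = 0) {v : Vec s} (hv : v ≠ 0) :
    2 * excess d k v = wt d v - k := by
  rw [excess, if_neg hv]
  exact Int.two_mul_ediv_two_of_even
    (((Int.even_coe_nat _).2 (even_wt hd v)).sub ((Int.even_coe_nat _).2 hk))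

theorem PIRFamily.excess_nonneg (h : PIRFamily d k) (v : Vec s) : 0 ≤ excess d k v := by
  unfold excess
  split_ifs with hv
  · exact le_rfl
  · exact Int.ediv_nonneg (sub_nonneg.2 (by exact_mod_cast h.le_wt hv)) zero_le_two

theorem four_mul_sum_excess (hk : Even k) (hd : ∑ j, d j = 0) (hd0 : ∀ j, d j ≠ 0) :
    4 * ∑ v, excess d k v = 2 ^ s * Fintype.card ι - 2 * (2 ^ s - 1) * k := by
  have hterm (v : Vec s) :
      4 * excess d k v = 2 * wt d v - 2 * k + if v = 0 then 2 * (k : ℤ) else 0 := by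
    split_ifs with hv
    · simp [hv, excess_zero, wt]
    · linarith [two_mul_excess hk hd hv]
  rw [mul_sum]
  simp only [hterm, sum_add_distrib, sum_sub_distrib, ← mul_sum, two_mul_sum_wt hd0]
  simp only [sum_const, card_univ, Fintype.card_pi, ZMod.card, prod_const, Fintype.card_fin,
    Int.nsmul_eq_mul, Nat.cast_pow, Nat.cast_ofNat, sum_ite_eq', mem_univ, if_true]
  ring

theorem mass_excess {Δ : ℤ} (hΔ : 2 ^ s = 8 * Δ) (hk : Even k) (hd : ∑ j, d j = 0)
    (hd0 : ∀ j, d j ≠ 0) {q : Vec s} (hq : q ≠ 0) :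
    mass (excess d k) q = Δ * (Fintype.card ι + mult d q - 2 * k) := by
  have hterm (v : Vec s) : 2 * (excess d k v * ind v q) = wt d v * ind v q - k * ind v q := by
    rcases eq_or_ne v 0 with rfl | hv
    · simp
    · rw [← mul_assoc, two_mul_excess hk hd hv, sub_mul]
  have hmass : 2 * mass (excess d k) q =
      mass (fun v => (wt d v : ℤ)) q - k * ∑ v, ind v q := by
    simp only [mass, mul_sum, hterm, sum_sub_distrib]
  have hind : 2 * ∑ v, ind v q = 2 ^ s := by
    rw [mul_sum, ← two_mul_sum_ind hq]
    simp only [ind_comm q]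
  have hwt := four_mul_mass_wt hd0 hq
  rw [hΔ] at hind hwt
  have hcount : ∑ v, ind v q = 4 * Δ := by omega
  rw [hcount] at hmass
  linarith

theorem PIRFamily.isRecoverable_excess (h : PIRFamily d k) {Δ : ℤ} (hΔ : 2 ^ s = 8 * Δ)
    (hk : Even k) (hd : ∑ j, d j = 0) (hd0 : ∀ j, d j ≠ 0) : IsRecoverable Δ (excess d k) := by
  have hmass {q : Vec s} (hq : q ≠ 0) := mass_excess hΔ hk hd hd0 hq
  have htwo {v : Vec s} {i : Fin s} (hv : v i = 1) :=
    two_mul_excess hk hd (ne_zero_of_apply_eq_one hv)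
  have hunit (i : Fin s) : (Pi.single i 1 : Vec s) ≠ 0 := by simp
  have hΔ0 : 0 ≤ Δ := by
    have hpos : (0 : ℤ) < 2 ^ s := by positivity
    omega
  have hfirst {i : Fin s} {v : Vec s} (hv : v i = 1) :
      Δ * excess d k v ≤ mass (excess d k) (Pi.single i 1) := by
    rw [hmass (hunit i)]
    have hrec := h.three_mul_add_wt_le hd0 hv
    have := htwo hv
    exact mul_le_mul_of_nonneg_left (by omega) hΔ0
  refine ⟨excess_zero d k, h.excess_nonneg, fun q => ?_, hfirst, fun {i v q} hv hvq => ?_⟩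
  · rcases eq_or_ne q 0 with rfl | hq
    · simp
    · exact ⟨_, hmass hq⟩
  · rcases eq_or_ne q 0 with rfl | hq
    · rw [mass_zero, add_zero, add_zero]
      exact (hfirst hv).trans (le_add_of_nonneg_left (mass_nonneg h.excess_nonneg _))
    · have hsum : Pi.single i 1 + q ≠ 0 := fun heq => by
        rw [add_eq_zero_iff_eq_of_zmod_two] at heq
        simp [← heq, hv] at hvq
      rw [hmass (hunit i), hmass hsum, hmass hq, ← mul_add, ← mul_add]
      have hrec := h.three_mul_add_wt_add_mult_le hd0 hv hvq hq
      have := htwo hv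
      exact mul_le_mul_of_nonneg_left (by omega) hΔ0

end Excess

/-! ### The smallest length in dimension five -/

section Bounds

/-- The smallest length of a PIR code of dimension five for even `r` between `2` and `16`: the
value is `2 * r + 2` up to `r = 10` and `3 * r / 2 + 7` from there on. -/
def minLength (r : ℕ) : ℕ := min (2 * r + 2) (3 * r / 2 + 7)

theorem PIRFamily.exists_isRecoverable {ι : Type*} [Fintype ι] {c : ι → Vec 5} {k : ℕ}
    (h : PIRFamily c k) (hk : Even k) (hk0 : 0 < k) :
    ∃ δ : Vec 5 → ℤ, IsRecoverable 4 δ ∧ 2 * ∑ v, δ v = 16 * Fintype.card ι - 31 * k := by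
  obtain ⟨d, hd, hd0, hdsum⟩ := h.exists_normalized hk hk0
  refine ⟨excess d k, hd.isRecoverable_excess (by norm_num) hk hdsum hd0, ?_⟩
  have hsum := four_mul_sum_excess hk hdsum hd0
  omega

theorem PIRFamily.le_length {n τ r : ℕ} (hr : Even r) (hr0 : 0 < r) (hr16 : r ≤ 16)
    {c : Fin n → Vec 5} (h : PIRFamily c (16 * τ + r)) : 31 * τ + minLength r ≤ n := by
  have hk : Even (16 * τ + r) := ((by decide : Even 16).mul_right τ).add hr
  obtain ⟨δ, hδ, hsum⟩ := h.exists_isRecoverable hk (by omega)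
  rw [Fintype.card_fin] at hsum
  push_cast at hsum
  obtain ⟨t, rfl⟩ := hr
  unfold minLength
  rcases hδ.sum_eq_or_fourteen_le with h0 | h7 | h8 | h14 <;> omega

theorem card_apply_eq_one {s : ℕ} (i : Fin s) :
    Fintype.card {x : Vec s // x i = 1} = 2 ^ (s - 1) := by
  have hcount : (#{x : Vec s | x i = 1} : ℤ) = ∑ x, ind (Pi.single i 1) x := by
    rw [natCast_card_filter]
    exact sum_congr rfl fun x _ => by simp [ind]
  have hsum := two_mul_sum_ind (v := (Pi.single i 1 : Vec s)) (by simp)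
  rw [← mul_sum, ← hcount, ← mul_pow_sub_one i.pos.ne'] at hsum
  rw [Fintype.card_subtype]
  exact_mod_cast mul_left_cancel₀ two_ne_zero hsum

theorem pirFamily_nonzero (s : ℕ) :
    PIRFamily (fun v : {v : Vec s // v ≠ 0} => v.1) (2 ^ (s - 1)) := fun i => by
  refine .of_fintype (card_apply_eq_one i)
    (fun x => ({x.1, x.1 + Pi.single i 1} : Finset (Vec s)).subtype (· ≠ 0))
    (fun x y hxy => disjoint_left.2 fun v hvx hvy => hxy (Subtype.ext ?_)) fun x => ?_
  · have hne (z w : {x : Vec s // x i = 1}) : z.1 ≠ w.1 + Pi.single i 1 := fun heq => by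
      simpa [z.2, w.2, CharTwo.add_self_eq_zero] using congrFun heq i
    rw [mem_subtype, mem_insert, mem_singleton] at hvx hvy
    rcases hvx with hvx | hvx <;> rcases hvy with hvy | hvy
    · exact hvx.symm.trans hvy
    · exact (hne x y (hvx.symm.trans hvy)).elim
    · exact (hne y x (hvy.symm.trans hvx)).elim
    · exact add_right_cancel (hvx.symm.trans hvy)
  · rw [sum_subtype_eq_sum_filter (fun v => v), sum_filter_ne_zero, sum_pair (by simp),
      ← add_assoc, ZModModule.add_self, zero_add]

theorem exists_pirFamily_sixteen : ∃ c : Fin 31 → Vec 5, PIRFamily c 16 :=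
  (pirFamily_nonzero 5).exists_fin (by simp [Fintype.card_subtype_compl, ZMod.card])

/-- The vector of the `s` lowest binary digits of `a`. -/
def digits (s a : ℕ) : Vec s := fun i => if a.testBit i then 1 else 0

theorem digits_xor (s a b : ℕ) : digits s (a ^^^ b) = digits s a + digits s b := by
  funext i
  simp only [digits, Nat.testBit_xor, Pi.add_apply]
  cases a.testBit i <;> cases b.testBit i <;> decide

theorem sum_map_digits (s : ℕ) (l : List ℕ) :
    (l.map (digits s)).sum = digits s (l.foldr (· ^^^ ·) 0) := by
  induction l with
  | nil => funext i; simp [digits]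
  | cons a l ih => rw [List.map_cons, List.sum_cons, ih, List.foldr_cons, digits_xor]

theorem digits_two_pow {s : ℕ} (i : Fin s) : digits s (2 ^ i.1) = Pi.single i 1 := by
  funext j
  simp [digits, Nat.testBit_two_pow, Pi.single_apply, Fin.ext_iff, eq_comm]

theorem packing_of_lists {s e : ℕ} {X : Finset ℕ} {L : List (List ℕ)} (hnd : L.flatten.Nodup)
    (hX : ∀ a ∈ L.flatten, a ∈ X) (hL : ∀ l ∈ L, l.foldr (· ^^^ ·) 0 = e) :
    Packing (fun a : X => digits s a) L.length (digits s e) := by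
  obtain ⟨hnodup, hdisj⟩ := List.nodup_flatten.1 hnd
  refine ⟨fun j => (L.get j).toFinset.subtype (· ∈ X), fun j j' hj => ?_, fun j => ?_⟩
  · have hget : List.Disjoint (L.get j) (L.get j') := by
      rcases lt_or_gt_of_ne hj with hlt | hlt
      · exact List.pairwise_iff_get.1 hdisj _ _ hlt
      · exact (List.pairwise_iff_get.1 hdisj _ _ hlt).symm
    refine disjoint_left.2 fun a ha ha' => ?_
    rw [mem_subtype, List.mem_toFinset] at ha ha'
    exact hget ha ha'
  · have hmem : L.get j ∈ L := List.get_mem L j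
    rw [sum_subtype_of_mem (digits s) fun a ha =>
        hX a (List.mem_flatten.2 ⟨_, hmem, List.mem_toFinset.1 ha⟩),
      List.sum_toFinset _ (hnodup _ hmem), sum_map_digits, hL _ hmem]

theorem exists_pirFamily_of_lists {s : ℕ} (n k : ℕ) (X : List ℕ) (T : Fin s → List (List ℕ))
    (h : X.toFinset.card = n ∧ ∀ i, (T i).length = k ∧ (T i).flatten.Nodup ∧
      (∀ a ∈ (T i).flatten, a ∈ X) ∧ ∀ l ∈ T i, l.foldr (· ^^^ ·) 0 = 2 ^ i.1) :
    ∃ c : Fin n → Vec s, PIRFamily c k := by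
  refine PIRFamily.exists_fin (c := fun a : X.toFinset => digits s a) (fun i => ?_)
    ((Fintype.card_coe _).trans h.1)
  obtain ⟨hlen, hnodup, hmem, hxor⟩ := h.2 i
  rw [← hlen, ← digits_two_pow]
  exact packing_of_lists hnodup (fun a ha => List.mem_toFinset.2 (hmem a ha)) hxor

theorem exists_pirFamily_two : ∃ c : Fin 6 → Vec 5, PIRFamily c 2 :=
  exists_pirFamily_of_lists 6 2
    [1, 2, 4, 8, 16, 31]
    ![[[1], [2, 4, 8, 16, 31]],
      [[2], [1, 4, 8, 16, 31]],
      [[4], [1, 2, 8, 16, 31]],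
      [[8], [1, 2, 4, 16, 31]],
      [[16], [1, 2, 4, 8, 31]]]
    (by decide)

theorem exists_pirFamily_four : ∃ c : Fin 10 → Vec 5, PIRFamily c 4 :=
  exists_pirFamily_of_lists 10 4
    [1, 2, 4, 8, 16, 21, 22, 25, 27, 30]
    ![[[1], [2, 21, 22], [4, 27, 30], [8, 16, 25]],
      [[2], [25, 27], [1, 21, 22], [4, 8, 16, 30]],
      [[4], [1, 27, 30], [2, 16, 22], [8, 21, 25]],
      [[8], [22, 30], [1, 16, 25], [2, 4, 21, 27]],
      [[16], [1, 8, 25], [2, 4, 22], [21, 27, 30]]]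
    (by decide)

theorem exists_pirFamily_six : ∃ c : Fin 14 → Vec 5, PIRFamily c 6 :=
  exists_pirFamily_of_lists 14 6
    [1, 2, 4, 5, 6, 8, 10, 13, 16, 19, 20, 26, 27, 29]
    ![[[1], [4, 5], [26, 27], [2, 16, 19], [6, 10, 13], [8, 20, 29]],
      [[2], [4, 6], [8, 10], [1, 16, 19], [5, 26, 29], [13, 20, 27]],
      [[4], [1, 5], [2, 6], [16, 20], [10, 19, 29], [8, 13, 26, 27]],
      [[8], [2, 10], [5, 13], [19, 27], [6, 20, 26], [1, 4, 16, 29]],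
      [[16], [4, 20], [10, 26], [13, 29], [1, 2, 19], [5, 6, 8, 27]]]
    (by decide)

theorem exists_pirFamily_eight : ∃ c : Fin 18 → Vec 5, PIRFamily c 8 :=
  exists_pirFamily_of_lists 18 8
    [1, 3, 7, 8, 9, 12, 13, 15, 16, 18, 19, 21, 23, 24, 25, 26, 28, 30]
    ![[[1], [8, 9], [12, 13], [18, 19], [24, 25], [3, 21, 23], [7, 26, 28], [15, 16, 30]],
      [[1, 3], [13, 15], [16, 18], [21, 23], [24, 26], [28, 30], [7, 9, 12], [8, 19, 25]],
      [[3, 7], [8, 12], [9, 13], [19, 23], [24, 28], [26, 30], [1, 16, 21], [15, 18, 25]],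
      [[8], [1, 9], [7, 15], [16, 24], [18, 26], [3, 21, 30], [12, 19, 23], [13, 25, 28]],
      [[16], [3, 19], [7, 23], [8, 24], [9, 25], [12, 28], [1, 15, 30], [13, 18, 21, 26]]]
    (by decide)

theorem exists_pirFamily_ten : ∃ c : Fin 22 → Vec 5, PIRFamily c 10 :=
  exists_pirFamily_of_lists 22 10
    [1, 2, 4, 5, 6, 8, 9, 10, 11, 12, 13, 14, 17, 18, 19, 21, 22, 24, 26, 27, 28, 29]
    ![[[1], [4, 5], [8, 9], [10, 11], [12, 13], [18, 19], [26, 27], [28, 29], [6, 17, 22],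
       [2, 14, 21, 24]],
      [[2], [4, 6], [8, 10], [9, 11], [12, 14], [17, 19], [24, 26], [1, 21, 22], [5, 27, 28],
       [13, 18, 29]],
      [[4], [1, 5], [2, 6], [8, 12], [9, 13], [10, 14], [17, 21], [18, 22], [24, 28],
       [11, 19, 26, 27, 29]],
      [[8], [1, 9], [2, 10], [4, 12], [5, 13], [6, 14], [18, 26], [19, 27], [21, 29],
       [11, 17, 22, 24, 28]],
      [[1, 17], [2, 18], [5, 21], [6, 22], [8, 24], [10, 26], [11, 27], [12, 28], [13, 29],
       [4, 9, 14, 19]]]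
    (by decide)

theorem exists_pirFamily_twelve : ∃ c : Fin 25 → Vec 5, PIRFamily c 12 :=
  exists_pirFamily_of_lists 25 12
    [2, 4, 5, 6, 7, 10, 11, 12, 13, 14, 15, 16, 17, 18, 19, 20, 21, 22, 23, 24, 25, 26, 27, 28, 31]
    ![[[4, 5], [6, 7], [10, 11], [12, 13], [14, 15], [16, 17], [18, 19], [20, 21], [22, 23],
       [24, 25], [26, 27], [2, 28, 31]],
      [[2], [4, 6], [5, 7], [12, 14], [13, 15], [16, 18], [17, 19], [20, 22], [21, 23], [24, 26],
       [25, 27], [10, 11, 28, 31]],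
      [[4], [2, 6], [10, 14], [11, 15], [16, 20], [17, 21], [18, 22], [19, 23], [24, 28], [27, 31],
       [5, 12, 13], [7, 25, 26]],
      [[2, 10], [4, 12], [5, 13], [6, 14], [7, 15], [16, 24], [17, 25], [18, 26], [19, 27],
       [20, 28], [23, 31], [11, 21, 22]],
      [[16], [2, 18], [4, 20], [5, 21], [6, 22], [7, 23], [10, 26], [11, 27], [12, 28], [15, 31],
       [13, 14, 19], [17, 24, 25]]]
    (by decide)

theorem exists_pirFamily_fourteen : ∃ c : Fin 28 → Vec 5, PIRFamily c 14 :=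
  exists_pirFamily_of_lists 28 14
    [1, 2, 3, 5, 6, 7, 9, 10, 11, 13, 14, 15, 16, 17, 18, 19, 20, 21, 22, 23, 24, 25, 26, 27, 28,
     29, 30, 31]
    ![[[1], [2, 3], [6, 7], [10, 11], [14, 15], [16, 17], [18, 19], [20, 21], [22, 23], [24, 25],
       [26, 27], [28, 29], [30, 31], [5, 9, 13]],
      [[2], [1, 3], [5, 7], [9, 11], [13, 15], [16, 18], [17, 19], [20, 22], [21, 23], [24, 26],
       [25, 27], [28, 30], [29, 31], [6, 10, 14]],
      [[1, 5], [2, 6], [3, 7], [9, 13], [10, 14], [11, 15], [16, 20], [17, 21], [18, 22], [19, 23],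
       [24, 28], [25, 29], [26, 30], [27, 31]],
      [[1, 9], [2, 10], [3, 11], [5, 13], [6, 14], [7, 15], [16, 24], [17, 25], [18, 26], [19, 27],
       [20, 28], [21, 29], [22, 30], [23, 31]],
      [[16], [1, 17], [2, 18], [3, 19], [5, 21], [6, 22], [7, 23], [9, 25], [10, 26], [11, 27],
       [13, 29], [14, 30], [15, 31], [20, 24, 28]]]
    (by decide)

theorem exists_pirFamily_minLength {r : ℕ} (hr : Even r) (hr0 : 0 < r) (hr16 : r ≤ 16) :
    ∃ c : Fin (minLength r) → Vec 5, PIRFamily c r := by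
  interval_cases r <;> first | exact absurd hr (by decide) | skip
  exacts [exists_pirFamily_two, exists_pirFamily_four, exists_pirFamily_six,
    exists_pirFamily_eight, exists_pirFamily_ten, exists_pirFamily_twelve,
    exists_pirFamily_fourteen, exists_pirFamily_sixteen]

theorem exists_pirFamily_add_simplex {m r : ℕ} (h : ∃ c : Fin m → Vec 5, PIRFamily c r) (τ : ℕ) :
    ∃ c : Fin (31 * τ + m) → Vec 5, PIRFamily c (16 * τ + r) := by
  induction τ with
  | zero => rwa [mul_zero, mul_zero, zero_add, zero_add]
  | succ τ ih =>
    obtain ⟨c, hc⟩ := ih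
    obtain ⟨d, hd⟩ := exists_pirFamily_sixteen
    rw [show 16 * (τ + 1) + r = 16 * τ + r + 16 by ring]
    exact PIRFamily.exists_fin (fun i => (hc i).sumElim (hd i)) (by
      rw [Fintype.card_sum, Fintype.card_fin, Fintype.card_fin]
      ring)

theorem P_five {r : ℕ} (hr : Even r) (hr0 : 0 < r) (hr16 : r ≤ 16) (τ : ℕ) :
    P 5 (16 * τ + r) = 31 * τ + minLength r := by
  have hiff (n : ℕ) := exists_isPIRCode_iff (n := n) (s := 5) (k := 16 * τ + r) (by omega)
  refine IsLeast.csInf_eq ⟨?_, fun n hn => ?_⟩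
  · exact (hiff _).2 (exists_pirFamily_add_simplex (exists_pirFamily_minLength hr hr0 hr16) τ)
  · obtain ⟨c, hc⟩ := (hiff n).1 hn
    exact hc.le_length hr hr0 hr16

theorem P_five_eq_minLength {r : ℕ} (hr : Even r) (hr0 : 0 < r) (hr16 : r ≤ 16) :
    P 5 r = minLength r := by
  simpa using P_five hr hr0 hr16 0

end Bounds

end PIR

theorem mainTheorem2 :
    PIR.P 5 2 = 6 ∧ PIR.P 5 4 = 10 ∧ PIR.P 5 6 = 14 ∧ PIR.P 5 8 = 18 ∧
    PIR.P 5 10 = 22 ∧ PIR.P 5 12 = 25 ∧ PIR.P 5 14 = 28 ∧ PIR.P 5 16 = 31 ∧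
    ∀ k : ℕ, Even k → 16 < k →
      PIR.P 5 k = PIR.P 5 (k - 16 * ((k - 1) / 16)) + 31 * ((k - 1) / 16) := by
  iterate 8 refine ⟨PIR.P_five_eq_minLength (by decide) (by decide) (by decide), ?_⟩
  intro k hk hk16
  obtain ⟨τ, r, hτ, hr0, hr16, rfl⟩ :
      ∃ τ r, (k - 1) / 16 = τ ∧ 0 < r ∧ r ≤ 16 ∧ k = 16 * τ + r :=
    ⟨(k - 1) / 16, k - 16 * ((k - 1) / 16), rfl, by omega, by omega, by omega⟩
  have hr : Even r := (Nat.even_add.1 hk).1 ((by decide : Even 16).mul_right τ)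
  rw [hτ, Nat.add_sub_cancel_left, PIR.P_five hr hr0 hr16 τ,
    PIR.P_five_eq_minLength hr hr0 hr16, add_comm]
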